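/- For a real matrix $A$ let $\|A\|$ be its operator (spectral) norm, and for a vector $v$ let $\|v\|$ be its Euclidean norm. For every $K,A\in\mathbb R$ there is a constant $C>0$, depending only on $K$ and $A$, such that the following holds for all positive integers $n,k$ with $k\ge e^2$ and $\log k\le K\log n$. (i) Let $Q_1,\dots,Q_n$ be independent, not necessarily identically distributed, random matrices with values in the symmetric non-negative definite real $k\times k$ matrices, with $\|Q_i\|\le M$ a.s. for every $i$, where $M\log n/n\le A$. Put $\widehat Q=\frac1n\sum_{i=1}^nQ_i$ and $Q=\frac1n\sum_{i=1}^nE[Q_i]$. Then $\|\widehat Q-Q\|$ is integrable and $$E\|\widehat Q-Q\|\le C\sqrt{\frac{M(1+\|Q\|)\log n}{n}}.$$ (ii) In particular, let $p_1,\dots,p_n$ be random vectors in $\mathbb R^k$ such that the matrices $Q_i=p_ip_i'$ are independent and $\|p_i\|\le\xi_k$ a.s. for every $i$, where $\xi_k^2\log n/n\le A$. Then, with $\widehat Q$ and $Q$ as in (i), $\|\widehat Q-Q\|$ is integrable and $$E\|\widehat Q-Q\|\le C\sqrt{\frac{\xi_k^2(1+\|Q\|)\log n}{n}}.$$ -/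

import Mathlib

open MeasureTheory ProbabilityTheory

/- `‖A‖` for a real matrix `A` is the operator norm induced by the Euclidean norms. -/
open scoped Matrix.Norms.L2Operator

noncomputable section

/-- The entrywise (product, that is, Borel) sigma-algebra on matrices. -/
instance instMeasurableSpaceMatrix {m n : Type*} : MeasurableSpace (Matrix m n ℝ) :=
  inferInstanceAs (MeasurableSpace (m → n → ℝ))

/-- The empirical mean `(1/n) ∑ᵢ Aᵢ` of the matrices `A₁, …, Aₙ`. -/
def empMean {n k : ℕ} (A : Fin n → Matrix (Fin k) (Fin k) ℝ) : Matrix (Fin k) (Fin k) ℝ :=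
  (n : ℝ)⁻¹ • ∑ i, A i

/-- The (entrywise) expectation of a random matrix. -/
def matExp {Ω : Type*} [MeasurableSpace Ω] (P : Measure Ω) {k : ℕ}
    (X : Ω → Matrix (Fin k) (Fin k) ℝ) : Matrix (Fin k) (Fin k) ℝ :=
  Matrix.of fun a b => ∫ ω, X ω a b ∂P

/-- The matrix `Q = (1/n) ∑ᵢ E[Qᵢ]`. -/
def popMean {Ω : Type*} [MeasurableSpace Ω] (P : Measure Ω) {n k : ℕ}
    (Q : Fin n → Ω → Matrix (Fin k) (Fin k) ℝ) : Matrix (Fin k) (Fin k) ℝ :=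
  empMean fun i => matExp P (Q i)

/-- The random variable `‖Q̂ - Q‖`, where `Q̂ = (1/n) ∑ᵢ Qᵢ` and `Q = (1/n) ∑ᵢ E[Qᵢ]`. -/
def meanDeviation {Ω : Type*} [MeasurableSpace Ω] (P : Measure Ω) {n k : ℕ}
    (Q : Fin n → Ω → Matrix (Fin k) (Fin k) ℝ) (ω : Ω) : ℝ :=
  ‖empMean (fun i => Q i ω) - popMean P Q‖

/-- The matrix `p p'`. -/
def outer {k : ℕ} (p : EuclideanSpace ℝ (Fin k)) : Matrix (Fin k) (Fin k) ℝ :=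
  Matrix.of fun a b => p a * p b

end

/-! The proof is symmetrization followed by Rudelson's inequality, closed by a self-bounding
argument. For fixed positive semidefinite `A i` and random signs, put X = ∑ εᵢ Aᵢ. Pairing each sign
vector with its flip at i acts as a discrete integration by parts: E tr X^(2t+2) ≤ (2t+1) ∑ᵢ E
tr(Aᵢ² X^(2t)) (`sum_trace_signedSum_pow_succ_le`). Positivity gives Aᵢ² ≤ M Aᵢ in the trace, so
each step costs a factor (2t+1) M ‖∑ Aᵢ‖. Iterating up to an exponent of order log k yields (E‖X‖)²
≤ 12 log k · M ‖∑ Aᵢ‖ (`signAverage_sq_le`). Symmetrization replaces the centred sum of the `Q i` by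
the signed sum. With D = E‖Q̂ - Q‖ and E‖Q̂‖ ≤ D + ‖Q‖, this becomes D² ≤ c (D + ‖Q‖), where c = 48
M log k / n (`sq_integral_meanDeviation_le`). The growth condition on k turns log k into log n, and
solving the quadratic inequality gives (i). Part (ii) is the rank-one case, with M = ξ². -/

lemma pow_mul_pow_add_le (a b : ℝ) {q r t : ℕ} (h : q + r = 2 * t) :
    a ^ q * b ^ r + a ^ r * b ^ q ≤ a ^ (2 * t) + b ^ (2 * t) := by
  have key : ∀ x y : ℝ, 0 ≤ x → 0 ≤ y → x ^ q * y ^ r + x ^ r * y ^ q ≤ x ^ (q + r) + y ^ (q + r) := by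
    intro x y hx hy
    have : 0 ≤ (x ^ q - y ^ q) * (x ^ r - y ^ r) := by
      rcases le_total x y with hxy | hxy
      · exact mul_nonneg_of_nonpos_of_nonpos (sub_nonpos.2 (pow_le_pow_left₀ hx hxy _))
          (sub_nonpos.2 (pow_le_pow_left₀ hx hxy _))
      · exact mul_nonneg (sub_nonneg.2 (pow_le_pow_left₀ hy hxy _))
          (sub_nonneg.2 (pow_le_pow_left₀ hy hxy _))
    rw [pow_add, pow_add]
    linarith
  have h1 := key |a| |b| (abs_nonneg a) (abs_nonneg b)
  rw [h, (even_two_mul t).pow_abs, (even_two_mul t).pow_abs] at h1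
  refine le_trans (le_trans (le_abs_self _) ((abs_add_le _ _).trans_eq ?_)) h1
  simp [abs_mul, abs_pow]

/-! ### Trace inequalities for symmetric matrices. -/

section trace

variable {m : Type*} [Fintype m] [DecidableEq m]

lemma Matrix.IsHermitian.exists_orthogonal_diagonal {W : Matrix m m ℝ} (hW : W.IsHermitian) :
    ∃ (U : Matrix m m ℝ) (l : m → ℝ), U.transpose * U = 1 ∧ U * U.transpose = 1 ∧
      ∀ q : ℕ, W ^ q = U * Matrix.diagonal (fun a => l a ^ q) * U.transpose := by
  have hs := hW.spectral_theorem
  have h1 := Unitary.coe_star_mul_self hW.eigenvectorUnitary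
  have h2 := Unitary.coe_mul_star_self hW.eigenvectorUnitary
  rw [Unitary.conjStarAlgAut_apply] at hs
  set U : Matrix m m ℝ := ↑hW.eigenvectorUnitary with hU
  have hst : star U = U.transpose := by
    rw [Matrix.star_eq_conjTranspose, Matrix.conjTranspose_eq_transpose_of_trivial]
  rw [Unitary.coe_star] at h2
  rw [hst] at hs h1
  change U * star U = 1 at h2
  rw [hst] at h2
  clear_value U
  generalize hW.eigenvalues = l at hs
  clear hU hW
  refine ⟨U, l, h1, h2, fun q => ?_⟩
  induction q with
  | zero => simp [h2]
  | succ q ih =>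
    rw [pow_succ, ih]
    nth_rewrite 1 [hs]
    calc _ = U * Matrix.diagonal (fun a => l a ^ q) * (U.transpose * U)
          * Matrix.diagonal (RCLike.ofReal ∘ l) * U.transpose := by
            simp only [mul_assoc]
      _ = _ := by
        rw [h1, mul_one, mul_assoc U, Matrix.diagonal_mul_diagonal]
        simp [pow_succ]

lemma trace_mul_diagonal_mul_transpose_mul_diagonal (G : Matrix m m ℝ) (d e : m → ℝ) :
    (G.transpose * Matrix.diagonal d * G * Matrix.diagonal e).trace
      = ∑ b, ∑ a, G a b ^ 2 * (d a * e b) := by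
  simp only [Matrix.trace, Matrix.diag_apply, Matrix.mul_diagonal]
  refine Finset.sum_congr rfl fun b _ => ?_
  rw [Matrix.mul_apply, Finset.sum_mul]
  refine Finset.sum_congr rfl fun a _ => ?_
  rw [Matrix.mul_diagonal, Matrix.transpose_apply]
  ring

/-- In eigenbases of `W` and `Y` every trace here is a sum over pairs of eigenvalues with the same
nonnegative weights `G a b ^ 2`, so the scalar inequality applies term by term. -/
lemma trace_mul_pow_mul_pow_add_le {H W Y : Matrix m m ℝ} (hH : H.IsHermitian)
    (hW : W.IsHermitian) (hY : Y.IsHermitian) {q r t : ℕ} (h : q + r = 2 * t) :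
    (H * W ^ q * H * Y ^ r).trace + (H * W ^ r * H * Y ^ q).trace
      ≤ (H * H * W ^ (2 * t)).trace + (H * H * Y ^ (2 * t)).trace := by
  obtain ⟨U, l, hU1, hU2, hUW⟩ := hW.exists_orthogonal_diagonal
  obtain ⟨V, k, hV1, hV2, hVY⟩ := hY.exists_orthogonal_diagonal
  have hHt : H.transpose = H := by
    rwa [Matrix.IsHermitian, Matrix.conjTranspose_eq_transpose_of_trivial] at hH
  set G := U.transpose * H * V with hG
  have key : ∀ q r : ℕ, (H * W ^ q * H * Y ^ r).trace
      = ∑ b, ∑ a, G a b ^ 2 * (l a ^ q * k b ^ r) := by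
    intro q r
    rw [← trace_mul_diagonal_mul_transpose_mul_diagonal, hUW, hVY, hG, ← mul_assoc,
      Matrix.trace_mul_comm]
    simp only [Matrix.transpose_mul, Matrix.transpose_transpose, hHt, mul_assoc]
  have e1 : (H * H * W ^ (2 * t)).trace = (H * W ^ (2 * t) * H * Y ^ 0).trace := by
    rw [pow_zero, mul_one, Matrix.trace_mul_comm (H * W ^ _) H, mul_assoc]
  have e2 : (H * H * Y ^ (2 * t)).trace = (H * W ^ 0 * H * Y ^ (2 * t)).trace := by
    rw [pow_zero, mul_one]
  rw [e1, e2]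
  simp only [key, ← Finset.sum_add_distrib, ← mul_add]
  refine Finset.sum_le_sum fun b _ => Finset.sum_le_sum fun a _ =>
    mul_le_mul_of_nonneg_left ?_ (sq_nonneg _)
  simpa using pow_mul_pow_add_le (l a) (k b) h

lemma norm_pow_le_trace_pow {X : Matrix m m ℝ} (hX : X.IsHermitian) {p : ℕ} (hp : p ≠ 0) :
    ‖X‖ ^ (2 * p) ≤ (X ^ (2 * p)).trace := by
  obtain ⟨U, l, hU1, hU2, hUX⟩ := hX.exists_orthogonal_diagonal
  have htr : (X ^ (2 * p)).trace = ∑ a, l a ^ (2 * p) := by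
    rw [hUX, Matrix.trace_mul_comm, ← mul_assoc, hU1, one_mul, Matrix.trace_diagonal]
  rw [htr]
  have hUm : U ∈ Matrix.unitaryGroup m ℝ := by
    rw [Matrix.mem_unitaryGroup_iff, Matrix.star_eq_conjTranspose,
      Matrix.conjTranspose_eq_transpose_of_trivial, hU2]
  have hnorm : ‖X‖ = ‖l‖ := by
    have h1 := hUX 1
    simp only [pow_one] at h1
    have h2 : U.transpose = star U := by
      rw [Matrix.star_eq_conjTranspose, Matrix.conjTranspose_eq_transpose_of_trivial]
    rw [h1, h2, CStarRing.norm_mul_mem_unitary _ (Unitary.star_mem hUm),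
      CStarRing.norm_mem_unitary_mul _ hUm, Matrix.l2_opNorm_diagonal]
  rw [hnorm]
  have hnn : ∀ a, 0 ≤ l a ^ (2 * p) := fun a => (even_two_mul p).pow_nonneg _
  -- For empty `m` the trace is 0, and it is `p ≠ 0` that makes the left side vanish too.
  rcases isEmpty_or_nonempty m with hm | hm
  · have : l = 0 := Subsingleton.elim _ _
    simp [this, hp]
  · obtain ⟨a, ha⟩ := Finite.exists_max fun a => ‖l a‖
    have : ‖l‖ = ‖l a‖ := le_antisymm ((pi_norm_le_iff_of_nonneg (norm_nonneg _)).2 ha)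
      (norm_le_pi_norm l a)
    rw [this, Real.norm_eq_abs, (even_two_mul p).pow_abs]
    exact Finset.single_le_sum (f := fun a => l a ^ (2 * p)) (fun a _ => hnn a) (Finset.mem_univ a)

lemma dotProduct_mulVec_le_norm_mul (V : Matrix m m ℝ) (g : m → ℝ) :
    g ⬝ᵥ V.mulVec g ≤ ‖V‖ * (g ⬝ᵥ g) := by
  have h1 := Matrix.l2_opNorm_mulVec V (WithLp.toLp 2 g)
  have h2 := real_inner_le_norm (WithLp.toLp 2 (V.mulVec g)) (WithLp.toLp 2 g)
  have h3 : g ⬝ᵥ g = ‖WithLp.toLp 2 g‖ ^ 2 := by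
    rw [← real_inner_self_eq_norm_sq, EuclideanSpace.inner_eq_star_dotProduct]
    simp
  rw [h3]
  have h4 : inner ℝ (WithLp.toLp 2 (V.mulVec g)) (WithLp.toLp 2 g) = g ⬝ᵥ V.mulVec g := by
    simp [EuclideanSpace.inner_eq_star_dotProduct]
  rw [h4] at h2
  refine h2.trans ?_
  rw [sq, ← mul_assoc]
  exact mul_le_mul_of_nonneg_right h1 (norm_nonneg _)

lemma trace_transpose_mul_mul_le (V G : Matrix m m ℝ) :
    (G.transpose * V * G).trace ≤ ‖V‖ * (G.transpose * G).trace := by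
  simp only [Matrix.trace, Matrix.diag_apply, Finset.mul_sum]
  refine Finset.sum_le_sum fun b _ => ?_
  have := dotProduct_mulVec_le_norm_mul V (fun a => G a b)
  refine le_of_eq_of_le ?_ (this.trans_eq ?_)
  · rw [mul_assoc, Matrix.mul_apply]; rfl
  · rw [Matrix.mul_apply]; rfl

open scoped MatrixOrder in
lemma Matrix.PosSemidef.exists_eq_conjTranspose_mul_self {Q : Matrix m m ℝ} (hQ : Q.PosSemidef) :
    ∃ B : Matrix m m ℝ, Q = B.conjTranspose * B :=
  CStarAlgebra.nonneg_iff_eq_star_mul_self.mp hQ.nonneg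

/-- A trace form of Q² ≤ ‖Q‖ Q. Writing Q = BᵀB, the left side is the trace of BBᵀ compressed by B
Xᵗ, and BBᵀ has the same norm as BᵀB. -/
lemma trace_sq_mul_pow_le {Q X : Matrix m m ℝ} (hQ : Q.PosSemidef) (hX : X.IsHermitian) (t : ℕ) :
    (Q * Q * X ^ (2 * t)).trace ≤ ‖Q‖ * (Q * X ^ (2 * t)).trace := by
  obtain ⟨B, rfl⟩ := hQ.exists_eq_conjTranspose_mul_self
  have hXt : (X ^ t).transpose = X ^ t := by
    rw [Matrix.transpose_pow]
    rw [Matrix.IsHermitian, Matrix.conjTranspose_eq_transpose_of_trivial] at hX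
    rw [hX]
  have hn : ‖B.conjTranspose * B‖ = ‖B * B.conjTranspose‖ := by
    rw [Matrix.l2_opNorm_conjTranspose_mul_self]
    have := Matrix.l2_opNorm_conjTranspose_mul_self B.conjTranspose
    rw [Matrix.conjTranspose_conjTranspose, Matrix.l2_opNorm_conjTranspose] at this
    exact this.symm
  have := trace_transpose_mul_mul_le (B * B.conjTranspose) (B * X ^ t)
  rw [hn, two_mul, pow_add]
  simp only [Matrix.conjTranspose_eq_transpose_of_trivial, Matrix.transpose_mul, hXt] at this ⊢
  refine le_of_eq_of_le ?_ (this.trans_eq ?_)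
  · rw [← mul_assoc, Matrix.trace_mul_comm]; simp only [mul_assoc]
  · rw [← mul_assoc (B.transpose * B), Matrix.trace_mul_comm (B.transpose * B * X ^ t)]
    simp only [mul_assoc]

lemma trace_mul_pow_le {S X : Matrix m m ℝ} (hX : X.IsHermitian) (t : ℕ) :
    (S * X ^ (2 * t)).trace ≤ ‖S‖ * (X ^ (2 * t)).trace := by
  have hXt : (X ^ t).transpose = X ^ t := by
    rw [Matrix.transpose_pow]
    rw [Matrix.IsHermitian, Matrix.conjTranspose_eq_transpose_of_trivial] at hX
    rw [hX]
  have := trace_transpose_mul_mul_le S (X ^ t)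
  rw [hXt] at this
  rw [two_mul, pow_add]
  refine le_of_eq_of_le ?_ this
  rw [← mul_assoc, Matrix.trace_mul_comm, mul_assoc]

lemma trace_mul_pow_nonneg {Q X : Matrix m m ℝ} (hQ : Q.PosSemidef) (hX : X.IsHermitian) (t : ℕ) :
    0 ≤ (Q * X ^ (2 * t)).trace := by
  have hXt : (X ^ t).conjTranspose = X ^ t := by rw [Matrix.conjTranspose_pow, hX]
  have h := (hQ.conjTranspose_mul_mul_same (X ^ t)).trace_nonneg
  rw [hXt] at h
  rwa [two_mul, pow_add, ← mul_assoc, Matrix.trace_mul_comm, ← mul_assoc]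

end trace

/-! ### Random signs and Rudelson's inequality. -/

noncomputable section

/-- The value `±1` of a sign encoded as a boolean. -/
def boolSign (b : Bool) : ℝ := if b then 1 else -1

lemma boolSign_mul_self (b : Bool) : boolSign b * boolSign b = 1 := by
  cases b <;> simp [boolSign]

lemma boolSign_not (b : Bool) : boolSign (!b) = -boolSign b := by
  cases b <;> simp [boolSign]

/-- The signed sum `∑ᵢ εᵢ Aᵢ`. -/
def signedSum {ι E : Type*} [Fintype ι] [AddCommGroup E] [Module ℝ E]
    (A : ι → E) (ε : ι → Bool) : E :=
  ∑ i, boolSign (ε i) • A i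

/-- Reversing the `i`-th sign. -/
def flipSign {ι : Type*} [DecidableEq ι] (i : ι) (ε : ι → Bool) : ι → Bool :=
  Function.update ε i (!ε i)

lemma flipSign_involutive {ι : Type*} [DecidableEq ι] (i : ι) :
    Function.Involutive (flipSign i) := by
  intro ε
  simp [flipSign]

section signs

variable {ι : Type*} [Fintype ι] [DecidableEq ι]

lemma sum_flipSign {N : Type*} [AddCommMonoid N] (i : ι) (f : (ι → Bool) → N) :
    ∑ ε, f (flipSign i ε) = ∑ ε, f ε :=
  Equiv.sum_comp (flipSign_involutive i).toPerm f

lemma signedSum_sub_flipSign {E : Type*} [AddCommGroup E] [Module ℝ E] (A : ι → E)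
    (i : ι) (ε : ι → Bool) :
    signedSum A ε - signedSum A (flipSign i ε) = (2 * boolSign (ε i)) • A i := by
  rw [signedSum, signedSum, ← Finset.sum_sub_distrib, Finset.sum_eq_single i]
  · rw [flipSign, Function.update_self, boolSign_not, ← sub_smul]
    congr 1
    ring
  · intro j _ hj
    rw [flipSign, Function.update_of_ne hj, sub_self]
  · simp

end signs

lemma pow_sub_pow_eq_sum {R : Type*} [Ring R] (x y : R) (n : ℕ) :
    x ^ n - y ^ n = ∑ q ∈ Finset.range n, x ^ q * (x - y) * y ^ (n - 1 - q) := by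
  induction n with
  | zero => simp
  | succ n ih =>
    rw [Finset.sum_range_succ]
    have h : ∀ q ∈ Finset.range n, x ^ q * (x - y) * y ^ (n + 1 - 1 - q)
        = x ^ q * (x - y) * y ^ (n - 1 - q) * y := by
      intro q hq
      have : n + 1 - 1 - q = n - 1 - q + 1 := by have := Finset.mem_range.1 hq; omega
      rw [this, pow_succ, ← mul_assoc]
    rw [Finset.sum_congr rfl h, ← Finset.sum_mul, ← ih]
    simp only [add_tsub_cancel_right, tsub_self, pow_zero, mul_one, pow_succ]
    noncomm_ring

lemma signedSum_isHermitian {ι m : Type*} [Fintype ι] {A : ι → Matrix m m ℝ} (hA : ∀ i, (A i).IsHermitian) (ε : ι → Bool) :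
    (signedSum A ε).IsHermitian := by
  unfold signedSum Matrix.IsHermitian
  rw [Matrix.conjTranspose_sum]
  refine Finset.sum_congr rfl fun i _ => ?_
  rw [Matrix.conjTranspose_smul, hA i]
  simp

variable {ι m : Type*} [Fintype ι] [DecidableEq ι] [Fintype m] [DecidableEq m]

/-- Telescoping the difference of powers leaves 2t+1 mixed traces. The factor 2 from `hXY` lets the
terms q and 2t-q be paired, and each pair is bounded by `trace_mul_pow_mul_pow_add_le`. -/
lemma trace_mul_pow_sub_pow_le {H X Y : Matrix m m ℝ} (hH : H.IsHermitian)
    (hX : X.IsHermitian) (hY : Y.IsHermitian) {s : ℝ} (hs : s * s = 1)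
    (hXY : X - Y = (2 * s) • H) (t : ℕ) :
    s * (H * (X ^ (2 * t + 1) - Y ^ (2 * t + 1))).trace
      ≤ (2 * t + 1) * ((H * H * X ^ (2 * t)).trace + (H * H * Y ^ (2 * t)).trace) := by
  have e1 : s * (H * (X ^ (2 * t + 1) - Y ^ (2 * t + 1))).trace
      = 2 * ∑ q ∈ Finset.range (2 * t + 1), (H * X ^ q * H * Y ^ (2 * t - q)).trace := by
    rw [pow_sub_pow_eq_sum, hXY, Finset.mul_sum, Matrix.trace_sum, Finset.mul_sum, Finset.mul_sum]
    refine Finset.sum_congr rfl fun q _ => ?_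
    simp only [Matrix.mul_smul, Matrix.smul_mul, Matrix.trace_smul, smul_eq_mul,
      add_tsub_cancel_right, ← mul_assoc]
    linear_combination 2 * (H * X ^ q * H * Y ^ (2 * t - q)).trace * hs
  have e2 : ∑ q ∈ Finset.range (2 * t + 1), (H * X ^ q * H * Y ^ (2 * t - q)).trace
      = ∑ q ∈ Finset.range (2 * t + 1), (H * X ^ (2 * t - q) * H * Y ^ q).trace := by
    rw [← Finset.sum_range_reflect]
    refine Finset.sum_congr rfl fun q hq => ?_
    have := Finset.mem_range.1 hq
    rw [show 2 * t + 1 - 1 - q = 2 * t - q by omega, show 2 * t - (2 * t - q) = q by omega]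
  rw [e1, two_mul]
  nth_rewrite 2 [e2]
  rw [← Finset.sum_add_distrib]
  refine (Finset.sum_le_card_nsmul _ _ _ fun q hq => trace_mul_pow_mul_pow_add_le hH hX hY
    (show q + (2 * t - q) = 2 * t by have := Finset.mem_range.1 hq; omega)).trans_eq ?_
  simp [mul_add]

lemma sum_trace_signedSum_pow_succ_le {A : ι → Matrix m m ℝ} (hA : ∀ i, (A i).IsHermitian)
    (t : ℕ) :
    ∑ ε, (signedSum A ε ^ (2 * (t + 1))).trace
      ≤ (2 * t + 1) * ∑ ε, ∑ i, (A i * A i * signedSum A ε ^ (2 * t)).trace := by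
  have h1 : ∀ ε, (signedSum A ε ^ (2 * (t + 1))).trace
      = ∑ i, boolSign (ε i) * (A i * signedSum A ε ^ (2 * t + 1)).trace := by
    intro ε
    rw [show 2 * (t + 1) = 2 * t + 1 + 1 by ring, pow_succ']
    nth_rewrite 1 [signedSum]
    rw [Finset.sum_mul, Matrix.trace_sum]
    simp
  have hcomm : ∑ ε, ∑ i, (A i * A i * signedSum A ε ^ (2 * t)).trace
      = ∑ i, ∑ ε, (A i * A i * signedSum A ε ^ (2 * t)).trace := Finset.sum_comm
  rw [Finset.sum_congr rfl fun ε _ => h1 ε, Finset.sum_comm, hcomm, Finset.mul_sum]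
  refine Finset.sum_le_sum fun i _ => ?_
  have h2 := sum_flipSign i fun ε : ι → Bool =>
    boolSign (ε i) * (A i * signedSum A ε ^ (2 * t + 1)).trace
  have h3 := sum_flipSign i fun ε : ι → Bool => (A i * A i * signedSum A ε ^ (2 * t)).trace
  have h4 : ∀ ε : ι → Bool,
      boolSign (ε i) * (A i * signedSum A ε ^ (2 * t + 1)).trace
        + boolSign (flipSign i ε i) * (A i * signedSum A (flipSign i ε) ^ (2 * t + 1)).trace
      ≤ (2 * t + 1) * ((A i * A i * signedSum A ε ^ (2 * t)).trace
        + (A i * A i * signedSum A (flipSign i ε) ^ (2 * t)).trace) := by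
    intro ε
    have := trace_mul_pow_sub_pow_le (hA i) (signedSum_isHermitian hA ε)
      (signedSum_isHermitian hA (flipSign i ε)) (boolSign_mul_self (ε i))
      (signedSum_sub_flipSign A i ε) t
    rw [mul_sub, Matrix.trace_sub] at this
    rw [show flipSign i ε i = !ε i by simp [flipSign], boolSign_not]
    linarith
  have h5 := Finset.sum_le_sum fun (ε : ι → Bool) (_ : ε ∈ Finset.univ) => h4 ε
  rw [Finset.sum_add_distrib, h2, ← Finset.mul_sum, Finset.sum_add_distrib, h3] at h5
  linarith

lemma trace_signedSum_pow_nonneg {ι m : Type*} [Fintype ι] [Fintype m] [DecidableEq m] {A : ι → Matrix m m ℝ} (hA : ∀ i, (A i).IsHermitian)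
    (ε : ι → Bool) (t : ℕ) : 0 ≤ (signedSum A ε ^ (2 * t)).trace := by
  rcases eq_or_ne t 0 with rfl | ht
  · simp [Matrix.trace_one]
  · exact (pow_nonneg (norm_nonneg _) _).trans (norm_pow_le_trace_pow (signedSum_isHermitian hA ε) ht)

/-- The moment form of the matrix Khintchine inequality for positive semidefinite matrices. -/
lemma sum_trace_signedSum_pow_le {A : ι → Matrix m m ℝ} (hA : ∀ i, (A i).PosSemidef) {M : ℝ}
    (hM : ∀ i, ‖A i‖ ≤ M) (hM0 : 0 ≤ M) {p t : ℕ} (ht : t ≤ p) :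
    ∑ ε, (signedSum A ε ^ (2 * t)).trace
      ≤ (2 * p * (M * ‖∑ i, A i‖)) ^ t * (2 ^ Fintype.card ι * Fintype.card m) := by
  have hH : ∀ i, (A i).IsHermitian := fun i => (hA i).1
  have hv : 0 ≤ M * ‖∑ i, A i‖ := mul_nonneg hM0 (norm_nonneg _)
  induction t with
  | zero => simp [Matrix.trace_one]
  | succ t ih =>
    -- Bounding every factor 2t+1 by the final 2p turns the recursion into a plain power.
    have ht' : (2 * t + 1 : ℝ) ≤ 2 * p := by
      have : 2 * t + 1 ≤ 2 * p := by omega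
      exact_mod_cast this
    have h2 : ∀ ε, ∑ i, (A i * A i * signedSum A ε ^ (2 * t)).trace
        ≤ M * ‖∑ i, A i‖ * (signedSum A ε ^ (2 * t)).trace := by
      intro ε
      have hX := signedSum_isHermitian hH ε
      calc ∑ i, (A i * A i * signedSum A ε ^ (2 * t)).trace
          ≤ ∑ i, M * (A i * signedSum A ε ^ (2 * t)).trace := by
            refine Finset.sum_le_sum fun i _ => (trace_sq_mul_pow_le (hA i) hX t).trans ?_
            refine mul_le_mul_of_nonneg_right (hM i) ?_
            exact trace_mul_pow_nonneg (hA i) hX t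
        _ = M * ((∑ i, A i) * signedSum A ε ^ (2 * t)).trace := by
            rw [← Finset.mul_sum, Finset.sum_mul, Matrix.trace_sum]
        _ ≤ M * (‖∑ i, A i‖ * (signedSum A ε ^ (2 * t)).trace) :=
            mul_le_mul_of_nonneg_left (trace_mul_pow_le hX t) hM0
        _ = _ := by ring
    calc _ ≤ (2 * t + 1) * ∑ ε, ∑ i, (A i * A i * signedSum A ε ^ (2 * t)).trace :=
          sum_trace_signedSum_pow_succ_le hH t
      _ ≤ (2 * t + 1) * ∑ ε, M * ‖∑ i, A i‖ * (signedSum A ε ^ (2 * t)).trace :=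
          mul_le_mul_of_nonneg_left (Finset.sum_le_sum fun ε _ => h2 ε) (by positivity)
      _ ≤ (2 * p) * ∑ ε, M * ‖∑ i, A i‖ * (signedSum A ε ^ (2 * t)).trace :=
          mul_le_mul_of_nonneg_right ht' (Finset.sum_nonneg fun ε _ =>
            mul_nonneg hv (trace_signedSum_pow_nonneg hH ε t))
      _ = (2 * p * (M * ‖∑ i, A i‖)) * ∑ ε, (signedSum A ε ^ (2 * t)).trace := by
          rw [← Finset.mul_sum]; ring
      _ ≤ (2 * p * (M * ‖∑ i, A i‖)) * ((2 * p * (M * ‖∑ i, A i‖)) ^ t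
            * (2 ^ Fintype.card ι * Fintype.card m)) :=
          mul_le_mul_of_nonneg_left (ih (by omega)) (by positivity)
      _ = _ := by ring

/-- The average of `‖∑ᵢ εᵢ Aᵢ‖` over all choices of signs. -/
def signAverage (A : ι → Matrix m m ℝ) : ℝ :=
  (2 ^ Fintype.card ι : ℝ)⁻¹ * ∑ ε : ι → Bool, ‖signedSum A ε‖

/-- Rudelson's inequality. -/
lemma signAverage_sq_le {A : ι → Matrix m m ℝ} (hA : ∀ i, (A i).PosSemidef) {M : ℝ}
    (hM : ∀ i, ‖A i‖ ≤ M) (hM0 : 0 ≤ M) (hk : Real.exp 1 ≤ Fintype.card m) :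
    signAverage A ^ 2 ≤ 12 * Real.log (Fintype.card m) * (M * ‖∑ i, A i‖) := by
  have hH : ∀ i, (A i).IsHermitian := fun i => (hA i).1
  have hk0 : (0 : ℝ) < Fintype.card m := (Real.exp_pos 1).trans_le hk
  have hlog : 1 ≤ Real.log (Fintype.card m) := (Real.le_log_iff_exp_le hk0).2 hk
  -- With this exponent the dimension is at most e^p, so after the p-th root it costs only a factor
  -- e ≤ 3; together with p ≤ 2 log k this gives 12 = 2·2·3.
  set p := ⌈Real.log (Fintype.card m)⌉₊ with hp
  have hp1 : Real.log (Fintype.card m) ≤ p := Nat.le_ceil _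
  have hp2 : (p : ℝ) ≤ 2 * Real.log (Fintype.card m) := by
    have := Nat.ceil_lt_add_one (zero_le_one.trans hlog)
    linarith
  have hp0 : p ≠ 0 := by
    rintro h
    rw [h] at hp1
    norm_num at hp1
    linarith
  have hv : 0 ≤ M * ‖∑ i, A i‖ := mul_nonneg hM0 (norm_nonneg _)
  have hkp : (Fintype.card m : ℝ) ≤ Real.exp 1 ^ p := by
    rw [← Real.exp_nat_mul, mul_one]
    exact (Real.log_le_iff_le_exp hk0).1 hp1
  have hpos : (0 : ℝ) < 2 ^ Fintype.card ι := by positivity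
  have h1 : signAverage A ^ (2 * p)
      ≤ (2 ^ Fintype.card ι : ℝ)⁻¹ * ∑ ε : ι → Bool, ‖signedSum A ε‖ ^ (2 * p) := by
    rw [signAverage, Finset.mul_sum, Finset.mul_sum]
    refine Real.pow_arith_mean_le_arith_mean_pow Finset.univ (fun _ => (2 ^ Fintype.card ι : ℝ)⁻¹)
      (fun ε : ι → Bool => ‖signedSum A ε‖) (fun _ _ => by positivity) ?_
      (fun _ _ => norm_nonneg _) _
    simp
  have h2 : signAverage A ^ (2 * p) ≤ (2 * p * (M * ‖∑ i, A i‖) * Real.exp 1) ^ p := by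
    calc _ ≤ _ := h1
      _ ≤ (2 ^ Fintype.card ι : ℝ)⁻¹ * ∑ ε : ι → Bool, (signedSum A ε ^ (2 * p)).trace := by
        refine mul_le_mul_of_nonneg_left (Finset.sum_le_sum fun ε _ => ?_) (by positivity)
        exact norm_pow_le_trace_pow (signedSum_isHermitian hH ε) hp0
      _ ≤ (2 ^ Fintype.card ι : ℝ)⁻¹ * ((2 * p * (M * ‖∑ i, A i‖)) ^ p
            * (2 ^ Fintype.card ι * Fintype.card m)) :=
        mul_le_mul_of_nonneg_left (sum_trace_signedSum_pow_le hA hM hM0 le_rfl) (by positivity)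
      _ = (2 * p * (M * ‖∑ i, A i‖)) ^ p * Fintype.card m := by field_simp
      _ ≤ (2 * p * (M * ‖∑ i, A i‖)) ^ p * Real.exp 1 ^ p :=
        mul_le_mul_of_nonneg_left hkp (by positivity)
      _ = _ := by rw [← mul_pow]
  rw [pow_mul] at h2
  have h3 := le_of_pow_le_pow_left₀ hp0 (by positivity) h2
  have he : Real.exp 1 ≤ 3 := by linarith [Real.exp_one_lt_d9]
  calc _ ≤ _ := h3
    _ ≤ 2 * (2 * Real.log (Fintype.card m)) * (M * ‖∑ i, A i‖) * 3 := by gcongr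
    _ = _ := by ring

end

/-! ### Symmetrization with an independent copy. -/

noncomputable section

section symmetrization

variable {ι Ω E : Type*} [Fintype ι] [MeasurableSpace Ω] {P : Measure Ω}
  [IsProbabilityMeasure P] [NormedAddCommGroup E] [NormedSpace ℝ E] [MeasurableSpace E]
  [BorelSpace E] [SecondCountableTopology E]

/-- The joint law of an independent family and an independent copy of it is invariant under
exchanging some of the coordinates. -/
lemma ProbabilityTheory.iIndepFun.integral_norm_sum_sub_eq {X : ι → Ω → E} (hX : ∀ i, Measurable (X i))
    (hind : iIndepFun X P) (ε : ι → Bool) :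
    ∫ z, ‖∑ i, (X i z.1 - X i z.2)‖ ∂(P.prod P)
      = ∫ z, ‖signedSum (fun i => X i z.1 - X i z.2) ε‖ ∂(P.prod P) := by
  have hZ : Measurable fun ω i => X i ω := measurable_pi_lambda _ hX
  set μ : ι → Measure E := fun i => P.map (X i) with hμ
  have : ∀ i, IsProbabilityMeasure (μ i) := fun i => Measure.isProbabilityMeasure_map (hX i).aemeasurable
  have hlaw : P.map (fun ω i => X i ω) = Measure.pi μ :=
    hind.map_fun_eq_pi_map fun i => (hX i).aemeasurable
  have hmp : MeasurePreserving (Prod.map (fun ω i => X i ω) (fun ω i => X i ω)) (P.prod P)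
      ((Measure.pi μ).prod (Measure.pi μ)) := by
    rw [← hlaw]
    exact (MeasurePreserving.mk hZ rfl).prod (MeasurePreserving.mk hZ rfl)
  have hmp2 := (measurePreserving_arrowProdEquivProdArrow E E ι μ μ).symm
  -- Swapping the pair at i negates its difference, which is the effect of the sign -1.
  have hmp3 : MeasurePreserving (fun (f : ι → E × E) i => if ε i then f i else (f i).swap)
      (Measure.pi fun i => (μ i).prod (μ i)) (Measure.pi fun i => (μ i).prod (μ i)) := by
    refine measurePreserving_pi (f := fun i (x : E × E) => if ε i then x else x.swap) _ _ fun i => ?_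
    cases ε i
    · simpa using Measure.measurePreserving_swap
    · exact MeasurePreserving.id _
  have h12 := hmp2.comp hmp
  have h123 := hmp3.comp h12
  set F : (ι → E × E) → ℝ := fun f => ‖∑ i, ((f i).1 - (f i).2)‖ with hF
  have hFm : Measurable F := by
    have : Continuous F := by fun_prop
    exact this.measurable
  have e1 := integral_map (μ := P.prod P) (f := F) h12.measurable.aemeasurable hFm.aestronglyMeasurable
  have e2 := integral_map (μ := P.prod P) (f := F) h123.measurable.aemeasurable hFm.aestronglyMeasurable
  rw [h12.map_eq] at e1
  rw [h123.map_eq] at e2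
  refine (e1.symm.trans e2).trans ?_
  refine integral_congr_ae (Filter.Eventually.of_forall fun z => ?_)
  simp only [hF, signedSum, Function.comp]
  congr 1
  refine Finset.sum_congr rfl fun i _ => ?_
  cases ε i
  all_goals simp [boolSign, MeasurableEquiv.arrowProdEquivProdArrow, Equiv.arrowProdEquivProdArrow]

lemma signedSum_sub {E : Type*} [AddCommGroup E] [Module ℝ E] (x y : ι → E) (ε : ι → Bool) :
    signedSum (fun i => x i - y i) ε = signedSum x ε - signedSum y ε := by
  simp [signedSum, smul_sub]

lemma integrable_signedSum {ι Ω E : Type*} [Fintype ι] [MeasurableSpace Ω] {P : Measure Ω}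
    [NormedAddCommGroup E] [NormedSpace ℝ E] {X : ι → Ω → E} (hX : ∀ i, Integrable (X i) P) (ε : ι → Bool) :
    Integrable (fun ω => signedSum (fun i => X i ω) ε) P :=
  integrable_finsetSum _ fun i _ => (hX i).smul _

/-- The symmetrization inequality, for a fixed choice of signs. -/
lemma ProbabilityTheory.iIndepFun.integral_norm_sum_sub_integral_le [CompleteSpace E] {X : ι → Ω → E}
    (hX : ∀ i, Measurable (X i)) (hind : iIndepFun X P) (hint : ∀ i, Integrable (X i) P)
    (ε : ι → Bool) :
    ∫ ω, ‖∑ i, X i ω - ∑ i, ∫ ω', X i ω' ∂P‖ ∂P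
      ≤ 2 * ∫ ω, ‖signedSum (fun i => X i ω) ε‖ ∂P := by
  have hS : Integrable (fun ω => ∑ i, X i ω) P := integrable_finsetSum _ fun i _ => hint i
  have hSe := integrable_signedSum hint ε
  have hD : Integrable (fun z : Ω × Ω => ∑ i, X i z.1 - ∑ i, X i z.2) (P.prod P) :=
    (hS.comp_fst P).sub (hS.comp_snd P)
  have h1 : ∀ ω, ‖∑ i, X i ω - ∑ i, ∫ ω', X i ω' ∂P‖
      ≤ ∫ ω', ‖∑ i, X i ω - ∑ i, X i ω'‖ ∂P := by
    -- The expectation is an integral over the independent copy, so the norm can be moved inside.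
    intro ω
    refine le_of_eq_of_le ?_ (norm_integral_le_integral_norm _)
    rw [integral_sub (integrable_const _) hS, integral_finsetSum _ fun i _ => hint i]
    simp
  calc _ ≤ ∫ ω, ∫ ω', ‖∑ i, X i ω - ∑ i, X i ω'‖ ∂P ∂P :=
        integral_mono (hS.sub (integrable_const _)).norm hD.norm.integral_prod_left h1
    _ = ∫ z, ‖∑ i, (X i z.1 - X i z.2)‖ ∂(P.prod P) := by
        rw [← integral_prod (f := fun z : Ω × Ω => ‖∑ i, X i z.1 - ∑ i, X i z.2‖) hD.norm]
        simp only [Finset.sum_sub_distrib]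
    _ = ∫ z, ‖signedSum (fun i => X i z.1) ε - signedSum (fun i => X i z.2) ε‖ ∂(P.prod P) := by
        rw [hind.integral_norm_sum_sub_eq hX ε]
        simp only [signedSum_sub]
    _ ≤ ∫ z, (‖signedSum (fun i => X i z.1) ε‖ + ‖signedSum (fun i => X i z.2) ε‖) ∂(P.prod P) :=
        integral_mono ((hSe.comp_fst P).sub (hSe.comp_snd P)).norm
          ((hSe.norm.comp_fst P).add (hSe.norm.comp_snd P)) fun z => norm_sub_le _ _
    _ = _ := by
        rw [integral_add (hSe.norm.comp_fst P) (hSe.norm.comp_snd P),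
          integral_fun_fst (fun ω => ‖signedSum (fun i => X i ω) ε‖),
          integral_fun_snd (fun ω => ‖signedSum (fun i => X i ω) ε‖)]
        simp [two_mul]

end symmetrization

lemma sq_integral_le_integral_sq {Ω : Type*} [MeasurableSpace Ω] {P : Measure Ω}
    [IsProbabilityMeasure P] {g : Ω → ℝ} (hg : MemLp g 2 P) :
    (∫ ω, g ω ∂P) ^ 2 ≤ ∫ ω, g ω ^ 2 ∂P := by
  have h1 := variance_nonneg g P
  rw [variance_eq_sub hg] at h1
  simpa using h1

instance instBorelSpaceMatrix {m n : Type*} [Countable m] [Countable n] :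
    BorelSpace (Matrix m n ℝ) :=
  inferInstanceAs (BorelSpace (m → n → ℝ))

variable {Ω ι m : Type*} [MeasurableSpace Ω] {P : Measure Ω} [IsProbabilityMeasure P]
  [Fintype ι] [DecidableEq ι] [Fintype m] [DecidableEq m]

/-- Symmetrization holds for each fixed sign vector, so it may be averaged over signs; Rudelson's
inequality then applies for almost every ω. The constant is 48 = 2²·12. -/
lemma sq_integral_norm_sum_sub_integral_le {Q : ι → Ω → Matrix m m ℝ} {M : ℝ} (hM0 : 0 ≤ M)
    (hQ : ∀ i, Measurable (Q i)) (hind : iIndepFun Q P)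
    (hpos : ∀ i, ∀ᵐ ω ∂P, (Q i ω).PosSemidef) (hM : ∀ i, ∀ᵐ ω ∂P, ‖Q i ω‖ ≤ M)
    (hk : Real.exp 1 ≤ Fintype.card m) :
    (∫ ω, ‖∑ i, Q i ω - ∑ i, ∫ ω', Q i ω' ∂P‖ ∂P) ^ 2
      ≤ 48 * Real.log (Fintype.card m) * (M * ∫ ω, ‖∑ i, Q i ω‖ ∂P) := by
  have hint : ∀ i, Integrable (Q i) P := fun i =>
    Integrable.of_bound (hQ i).aestronglyMeasurable M (hM i)
  have hS : Integrable (fun ω => ∑ i, Q i ω) P := integrable_finsetSum _ fun i _ => hint i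
  have hsi : ∀ ε, Integrable (fun ω => ‖signedSum (fun i => Q i ω) ε‖) P := fun ε =>
    (integrable_signedSum hint ε).norm
  set g : Ω → ℝ := fun ω => signAverage fun i => Q i ω with hg
  have hgi : Integrable g P := (integrable_finsetSum _ fun ε _ => hsi ε).const_mul _
  have hpos' := ae_all_iff.2 hpos
  have hM' := ae_all_iff.2 hM
  have hgsq : ∀ᵐ ω ∂P, g ω ^ 2 ≤ 12 * Real.log (Fintype.card m) * (M * ‖∑ i, Q i ω‖) := by
    filter_upwards [hpos', hM'] with ω h1 h2
    exact signAverage_sq_le h1 h2 hM0 hk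
  have hbi : Integrable (fun ω => 12 * Real.log (Fintype.card m) * (M * ‖∑ i, Q i ω‖)) P :=
    (hS.norm.const_mul _).const_mul _
  have hgsi : Integrable (fun ω => g ω ^ 2) P :=
    hbi.mono' (hgi.aestronglyMeasurable.pow 2) (by
      filter_upwards [hgsq] with ω h
      rwa [Real.norm_of_nonneg (sq_nonneg _)])
  have hL2 : MemLp g 2 P := (memLp_two_iff_integrable_sq hgi.aestronglyMeasurable).2 hgsi
  have h1 : ∫ ω, ‖∑ i, Q i ω - ∑ i, ∫ ω', Q i ω' ∂P‖ ∂P ≤ 2 * ∫ ω, g ω ∂P := by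
    have h2 : ∫ ω, g ω ∂P = (2 ^ Fintype.card ι : ℝ)⁻¹
        * ∑ ε : ι → Bool, ∫ ω, ‖signedSum (fun i => Q i ω) ε‖ ∂P := by
      rw [← integral_finsetSum _ fun ε _ => hsi ε, ← integral_const_mul]
      rfl
    have h3 := Finset.sum_le_sum fun (ε : ι → Bool) (_ : ε ∈ Finset.univ) =>
      hind.integral_norm_sum_sub_integral_le hQ hint ε
    rw [← Finset.mul_sum, Finset.sum_const, nsmul_eq_mul] at h3
    have h4 : (0 : ℝ) < 2 ^ Fintype.card ι := by positivity
    rw [h2, ← mul_assoc, mul_comm (2 : ℝ) (_⁻¹), mul_assoc, inv_mul_eq_div, le_div_iff₀ h4,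
      mul_comm]
    simpa using h3
  calc _ ≤ (2 * ∫ ω, g ω ∂P) ^ 2 :=
        pow_le_pow_left₀ (integral_nonneg fun _ => norm_nonneg _) h1 2
    _ = 4 * (∫ ω, g ω ∂P) ^ 2 := by ring
    _ ≤ 4 * ∫ ω, 12 * Real.log (Fintype.card m) * (M * ‖∑ i, Q i ω‖) ∂P :=
        mul_le_mul_of_nonneg_left ((sq_integral_le_integral_sq hL2).trans
          (integral_mono_ae hgsi hbi hgsq)) (by norm_num)
    _ = _ := by rw [integral_const_mul, integral_const_mul]; ring

end

/-! ### The self-bounding inequality for the mean deviation. -/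

section deviation

variable {Ω : Type*} [MeasurableSpace Ω] {P : Measure Ω} {n k : ℕ}

lemma matExp_eq_integral {X : Ω → Matrix (Fin k) (Fin k) ℝ} (hX : Integrable X P) :
    matExp P X = ∫ ω, X ω ∂P := by
  ext a b
  let L : Matrix (Fin k) (Fin k) ℝ →L[ℝ] ℝ := LinearMap.toContinuousLinearMap
    { toFun := fun A => A a b, map_add' := fun _ _ => rfl, map_smul' := fun _ _ => rfl }
  exact L.integral_comp_comm hX

lemma meanDeviation_eq {Q : Fin n → Ω → Matrix (Fin k) (Fin k) ℝ}
    (hQ : ∀ i, Integrable (Q i) P) :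
    meanDeviation P Q = fun ω => (n : ℝ)⁻¹ * ‖∑ i, Q i ω - ∑ i, ∫ ω', Q i ω' ∂P‖ := by
  ext ω
  simp only [meanDeviation, popMean, empMean, matExp_eq_integral (hQ _)]
  rw [← smul_sub, norm_smul, Real.norm_of_nonneg (by positivity)]

variable [IsProbabilityMeasure P]

lemma integrable_meanDeviation {Q : Fin n → Ω → Matrix (Fin k) (Fin k) ℝ}
    (hQ : ∀ i, Integrable (Q i) P) : Integrable (meanDeviation P Q) P := by
  rw [meanDeviation_eq hQ]
  exact ((integrable_finsetSum _ fun i _ => hQ i).sub (integrable_const _)).norm.const_mul _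

lemma sq_integral_meanDeviation_le {Q : Fin n → Ω → Matrix (Fin k) (Fin k) ℝ} {M : ℝ}
    (hn : n ≠ 0) (hM0 : 0 ≤ M)
    (hQ : ∀ i, Measurable (Q i)) (hind : iIndepFun Q P)
    (hpos : ∀ i, ∀ᵐ ω ∂P, (Q i ω).PosSemidef) (hM : ∀ i, ∀ᵐ ω ∂P, ‖Q i ω‖ ≤ M)
    (hk : Real.exp 1 ≤ k) :
    (∫ ω, meanDeviation P Q ω ∂P) ^ 2
      ≤ 48 * Real.log k * M / n * (∫ ω, meanDeviation P Q ω ∂P + ‖popMean P Q‖) := by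
  have hint : ∀ i, Integrable (Q i) P := fun i =>
    Integrable.of_bound (hQ i).aestronglyMeasurable M (hM i)
  have hn0 : (0 : ℝ) < n := by positivity
  have hk1 : (1 : ℝ) ≤ k := (Real.one_le_exp zero_le_one).trans hk
  have hlog := Real.log_nonneg hk1
  have h1 := sq_integral_norm_sum_sub_integral_le hM0 hQ hind hpos hM
    (by rwa [Fintype.card_fin])
  rw [Fintype.card_fin] at h1
  have hdev := integrable_meanDeviation hint
  have h2 : ∫ ω, ‖∑ i, Q i ω‖ ∂P ≤ n * (∫ ω, meanDeviation P Q ω ∂P + ‖popMean P Q‖) := by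
    have h3 : ∀ ω, ‖∑ i, Q i ω‖ ≤ n * (meanDeviation P Q ω + ‖popMean P Q‖) := by
      intro ω
      have h4 : ‖empMean fun i => Q i ω‖ ≤ meanDeviation P Q ω + ‖popMean P Q‖ :=
        norm_le_norm_sub_add _ _
      rw [empMean, norm_smul, Real.norm_of_nonneg (by positivity), inv_mul_eq_div,
        div_le_iff₀ hn0] at h4
      linarith
    refine (integral_mono (integrable_finsetSum _ fun i _ => hint i).norm
      (Integrable.const_mul (f := fun ω => meanDeviation P Q ω + ‖popMean P Q‖)
        (hdev.add (integrable_const _)) _) h3).trans_eq ?_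
    rw [integral_const_mul, integral_add hdev (integrable_const _)]
    simp
  have h5 : ∫ ω, ‖∑ i, Q i ω - ∑ i, ∫ ω', Q i ω' ∂P‖ ∂P = n * ∫ ω, meanDeviation P Q ω ∂P := by
    rw [meanDeviation_eq hint, integral_const_mul, ← mul_assoc, mul_inv_cancel₀ hn0.ne', one_mul]
  rw [h5] at h1
  set D := ∫ ω, meanDeviation P Q ω ∂P
  have h6 : ((n : ℝ) * D) ^ 2 ≤ 48 * Real.log k * (M * (n * (D + ‖popMean P Q‖))) :=
    h1.trans (by gcongr)
  have h7 : D ^ 2 = ((n : ℝ) * D) ^ 2 / n ^ 2 := by field_simp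
  rw [h7, div_le_iff₀ (by positivity)]
  refine h6.trans_eq ?_
  field_simp

end deviation

lemma le_sqrt_of_sq_le_mul_add {D b c q A L : ℝ} (hq : 0 ≤ q) (hb : 0 ≤ b)
    (hL : 0 ≤ L) (hDq : 0 ≤ D + q)
    (h : D ^ 2 ≤ c * (D + q)) (hc : c ≤ L * b) (hbA : b ≤ A) :
    D ≤ √(L * (L * A + 2)) * √(b * (1 + q)) := by
  have h1 : D ^ 2 ≤ L * b * (D + q) := h.trans (mul_le_mul_of_nonneg_right hc hDq)
  have h2 : 0 ≤ L * b := mul_nonneg hL hb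
  -- With c = Lb, the term cD is absorbed through 2cD ≤ D² + c².
  have h3 : D ^ 2 ≤ (L * b) ^ 2 + 2 * (L * b) * q := by nlinarith [sq_nonneg (D - L * b)]
  have h4 : (L * b) ^ 2 ≤ (L * b) * (L * A) := by
    rw [sq]
    exact mul_le_mul_of_nonneg_left (mul_le_mul_of_nonneg_left hbA hL) h2
  have h5 : 0 ≤ L * b * (L * A) * q :=
    mul_nonneg (mul_nonneg h2 (mul_nonneg hL (hb.trans hbA))) hq
  rw [← Real.sqrt_mul (mul_nonneg hL (by have := mul_nonneg hL (hb.trans hbA); linarith))]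
  refine Real.le_sqrt_of_sq_le ?_
  nlinarith

/-! ### Rank-one matrices and the final bounds. -/

lemma outer_eq_vecMulVec {k : ℕ} (p : EuclideanSpace ℝ (Fin k)) :
    outer p = Matrix.vecMulVec p.ofLp (star p.ofLp) := by
  ext a b
  simp [outer, Matrix.vecMulVec_apply]

lemma outer_posSemidef {k : ℕ} (p : EuclideanSpace ℝ (Fin k)) : (outer p).PosSemidef := by
  rw [outer_eq_vecMulVec]
  exact Matrix.posSemidef_vecMulVec_self_star _

lemma norm_outer_le {k : ℕ} (p : EuclideanSpace ℝ (Fin k)) : ‖outer p‖ ≤ ‖p‖ ^ 2 := by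
  rw [Matrix.l2_opNorm_def]
  refine ContinuousLinearMap.opNorm_le_bound _ (sq_nonneg _) fun x => ?_
  have : (Matrix.toEuclideanLin (𝕜 := ℝ) (outer p)) x = (inner ℝ p x) • p := by
    ext a
    rw [Matrix.toLpLin_apply]
    simp only [outer, Matrix.mulVec, dotProduct, Matrix.of_apply, PiLp.smul_apply, smul_eq_mul,
      PiLp.inner_apply, Finset.sum_mul]
    refine Finset.sum_congr rfl fun b _ => ?_
    simp
    ring
  change ‖Matrix.toEuclideanLin (𝕜 := ℝ) (outer p) x‖ ≤ _
  rw [this, norm_smul]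
  have := norm_inner_le_norm (𝕜 := ℝ) p x
  nlinarith [norm_nonneg p]

lemma measurable_outer {k : ℕ} : Measurable (outer (k := k)) := by
  refine measurable_pi_lambda _ fun a => measurable_pi_lambda _ fun b => ?_
  change Measurable fun p : EuclideanSpace ℝ (Fin k) => p a * p b
  fun_prop

theorem expected_meanDeviation_le {Ω : Type*} [MeasurableSpace Ω] {P : Measure Ω}
    [IsProbabilityMeasure P] {n k : ℕ} {K A M : ℝ} (hk : Real.exp 2 ≤ k)
    (hkn : Real.log k ≤ K * Real.log n) {Q : Fin n → Ω → Matrix (Fin k) (Fin k) ℝ}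
    (hQ : ∀ i, Measurable (Q i)) (hind : iIndepFun Q P)
    (hpos : ∀ i, ∀ᵐ ω ∂P, (Q i ω).PosSemidef) (hM : ∀ i, ∀ᵐ ω ∂P, ‖Q i ω‖ ≤ M)
    (hA : M * Real.log n / n ≤ A) :
    Integrable (meanDeviation P Q) P ∧
      ∫ ω, meanDeviation P Q ω ∂P ≤ √(48 * |K| * (48 * |K| * |A| + 2))
        * √(M * (1 + ‖popMean P Q‖) * Real.log n / n) := by
  have hk1 : Real.exp 1 ≤ k := (Real.exp_le_exp.2 one_le_two).trans hk
  have hlogk : 1 ≤ Real.log k := (Real.le_log_iff_exp_le ((Real.exp_pos 1).trans_le hk1)).2 hk1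
  -- At n = 0 the convention log 0 = 0 would force log k ≤ 0.
  have hn : n ≠ 0 := by
    rintro rfl
    simp at hkn
    linarith
  have hM0 : 0 ≤ M := by
    obtain ⟨ω, hω⟩ := (hM ⟨0, Nat.pos_of_ne_zero hn⟩).exists
    exact (norm_nonneg _).trans hω
  have hlogn : 0 ≤ Real.log n := Real.log_natCast_nonneg n
  refine ⟨integrable_meanDeviation fun i =>
    Integrable.of_bound (hQ i).aestronglyMeasurable M (hM i), ?_⟩
  have h := sq_integral_meanDeviation_le hn hM0 hQ hind hpos hM hk1
  have hD : 0 ≤ ∫ ω, meanDeviation P Q ω ∂P := integral_nonneg fun _ => norm_nonneg _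
  have hc : 48 * Real.log k * M / n ≤ 48 * |K| * (M * Real.log n / n) := by
    calc 48 * Real.log k * M / n ≤ 48 * (|K| * Real.log n) * M / n := by
          gcongr
          exact hkn.trans (mul_le_mul_of_nonneg_right (le_abs_self K) hlogn)
      _ = _ := by ring
  refine (le_sqrt_of_sq_le_mul_add (norm_nonneg _) (by positivity) (by positivity)
    (add_nonneg hD (norm_nonneg _)) h hc (hA.trans (le_abs_self A))).trans_eq ?_
  congr 2
  ring

theorem mainTheorem12 (K A : ℝ) :
    ∃ C : ℝ, 0 < C ∧
      ∀ (Ω : Type*) [MeasurableSpace Ω] (P : Measure Ω) [IsProbabilityMeasure P] (n k : ℕ),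
        Real.exp 2 ≤ (k : ℝ) → Real.log k ≤ K * Real.log n →
        (∀ (Q : Fin n → Ω → Matrix (Fin k) (Fin k) ℝ) (M : ℝ),
          (∀ i, Measurable (Q i)) → iIndepFun Q P →
          (∀ i, ∀ᵐ ω ∂P, (Q i ω).PosSemidef) →
          (∀ i, ∀ᵐ ω ∂P, ‖Q i ω‖ ≤ M) →
          M * Real.log n / n ≤ A →
          Integrable (meanDeviation P Q) P ∧
          ∫ ω, meanDeviation P Q ω ∂P
            ≤ C * √(M * (1 + ‖popMean P Q‖) * Real.log n / n)) ∧
        (∀ (p : Fin n → Ω → EuclideanSpace ℝ (Fin k)) (ξ : ℝ),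
          (∀ i, Measurable (p i)) → iIndepFun (fun i ω => outer (p i ω)) P →
          (∀ i, ∀ᵐ ω ∂P, ‖p i ω‖ ≤ ξ) →
          ξ ^ 2 * Real.log n / n ≤ A →
          Integrable (meanDeviation P fun i ω => outer (p i ω)) P ∧
          ∫ ω, meanDeviation P (fun i ω => outer (p i ω)) ω ∂P
            ≤ C * √(ξ ^ 2 * (1 + ‖popMean P fun i ω => outer (p i ω)‖) * Real.log n / n)) := by
  -- The summand 1 keeps the constant positive when K = 0.
  refine ⟨√(48 * |K| * (48 * |K| * |A| + 2)) + 1, by positivity, ?_⟩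
  intro Ω _ P _ n k hk hkn
  have hC : √(48 * |K| * (48 * |K| * |A| + 2)) ≤ √(48 * |K| * (48 * |K| * |A| + 2)) + 1 := by
    linarith
  constructor
  · intro Q M hQ hind hpos hM hA
    obtain ⟨h1, h2⟩ := expected_meanDeviation_le hk hkn hQ hind hpos hM hA
    exact ⟨h1, h2.trans (mul_le_mul_of_nonneg_right hC (Real.sqrt_nonneg _))⟩
  · intro p ξ hp hind hξ hA
    obtain ⟨h1, h2⟩ := expected_meanDeviation_le (Q := fun i ω => outer (p i ω)) hk hkn
      (fun i => measurable_outer.comp (hp i)) hind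
      (fun i => Filter.Eventually.of_forall fun ω => outer_posSemidef _)
      (fun i => (hξ i).mono fun ω h => (norm_outer_le _).trans
        (pow_le_pow_left₀ (norm_nonneg _) h 2)) hA
    exact ⟨h1, h2.trans (mul_le_mul_of_nonneg_right hC (Real.sqrt_nonneg _))⟩
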